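/- For a ring $R$ let $S(R)=\{a^2 : a\in R\}$ (so $0\in S(R)$) and, for $n\in\mathbb{N}$, let $$N_n(R)=\inf\{\,|A+A| : A\subseteq S(R),\ |A|=n\,\},\qquad A+A=\{a+b : a,b\in A\}.$$ Let $p$ be a prime and $\mathbb{Z}_p=\mathbb{Z}/p\mathbb{Z}$. There is a set $A\subseteq S(\mathbb{Z}_p)$ with $|A|=5$ if and only if $p\ge 11$, and for these primes $$N_5(\mathbb{Z}_p)=\begin{cases} 9 & \text{if } p=17,\ p=23 \text{ or } p\ge 41,\\ 10 & \text{if } p\in\{11,19,29,31,37\},\\ 11 & \text{if } p=13.\end{cases}$$ -/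

import Mathlib

open scoped Pointwise

/-- The set `S(R) = {a ^ 2 | a ∈ R}` of squares in a ring `R` (zero is a square). -/
def ringSquares (R : Type*) [Ring R] : Set R := {x | ∃ a : R, x = a ^ 2}

/-- `N_n(R)`, the infimum of `|A + A|` over all `n`-element sets `A` of squares in `R`.
It is taken in `ℕ∞`, so it is `⊤` exactly when `R` has no `n`-element set of squares. -/
noncomputable def minSquareSumset (n : ℕ) (R : Type*) [Ring R] [DecidableEq R] : ℕ∞ :=
  ⨅ A : {A : Finset R // (A : Set R) ⊆ ringSquares R ∧ A.card = n},
    ((A.1 + A.1).card : ℕ∞)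

/-! For `p ≥ 11`, Cauchy–Davenport gives at least 9 sums, and a five-term arithmetic progression
attains 9. So the value is 9 as soon as five squares form a progression. For `p ≥ 41` this follows
from `exists_smooth_ap`: whatever the quadratic characters of -1, 2, 3, 5, 7, 11, 13 are, some
integer progression has constant character apart from a possible zero term, and multiplying it by an
element of that character makes every term a square. The primes 17 and 23 have explicit
progressions. For the other primes the upper bounds are explicit sets. The lower bounds are finite
checks (`le_card_add_of_sumsetsLarge`): scaling by a square puts 1 in the set, and sumsets of the
remaining candidates are counted with bit masks. -/

/-! ### Counting sums modulo `p` with bit masks -/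

/-- The natural number whose binary digits are set exactly at the elements of `l`. -/
def bitMask (l : List ℕ) : ℕ := l.foldr (fun a m => Nat.lor (Nat.shiftLeft 1 a) m) 0

/-- The natural number whose binary digits are set at the sums of two elements of `l`. -/
def sumsetMask (l : List ℕ) : ℕ :=
  l.foldr (fun a m => Nat.lor (Nat.shiftLeft (bitMask l) a) m) 0

/-- Folds the binary digits of `n` at positions `k` and `k + p` together, for `k < p`. -/
def residueMask (p n : ℕ) : ℕ := Nat.lor (Nat.mod n (Nat.pow 2 p)) (Nat.shiftRight n p)

/-- Tests whether `n` has at least `k` nonzero binary digits, by clearing the lowest ones. -/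
def hasManyBits : ℕ → ℕ → Bool
  | 0, _ => true
  | k + 1, n => Nat.rec false (fun j _ => hasManyBits k (Nat.land (Nat.succ j) j)) n

/-- Tests whether each set made of `1` and four elements of `L` has at least `k` sums
modulo `p`. -/
def sumsetsLarge (p k : ℕ) (L : List ℕ) : Bool :=
  (L.sublistsLen 4).all fun l => hasManyBits k (residueMask p (sumsetMask (1 :: l)))

theorem mem_of_testBit_bitMask {l : List ℕ} {k : ℕ} (h : (bitMask l).testBit k = true) :
    k ∈ l := by
  induction l with
  | nil => simp [bitMask] at h
  | cons a l ih =>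
    have e : bitMask (a :: l) = 1 <<< a ||| bitMask l := rfl
    rw [e, Nat.testBit_or, Bool.or_eq_true] at h
    rcases h with h | h
    · rw [Nat.one_shiftLeft, Nat.testBit_two_pow] at h
      simp at h
      simp [h]
    · exact List.mem_cons_of_mem _ (ih h)

theorem exists_add_of_testBit_sumsetMask {l : List ℕ} {k : ℕ}
    (h : (sumsetMask l).testBit k = true) : ∃ a ∈ l, ∃ b ∈ l, a + b = k := by
  have aux (l' : List ℕ)
      (h : (l'.foldr (fun a m => Nat.lor (Nat.shiftLeft (bitMask l) a) m) 0).testBit k = true) :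
      ∃ a ∈ l', ∃ b ∈ l, a + b = k := by
    induction l' with
    | nil => simp at h
    | cons a l' ih =>
      rw [List.foldr_cons] at h
      change (bitMask l <<< a ||| _).testBit k = true at h
      rw [Nat.testBit_or, Bool.or_eq_true] at h
      rcases h with h | h
      · rw [Nat.testBit_shiftLeft, Bool.and_eq_true, decide_eq_true_eq] at h
        exact ⟨a, by simp, k - a, mem_of_testBit_bitMask h.2, by lia⟩
      · obtain ⟨x, hx, hb⟩ := ih h
        exact ⟨x, List.mem_cons_of_mem _ hx, hb⟩
  exact aux l h

/-- `n &&& (n - 1)` is a submask of `n` and smaller than `n`, so each round of the test loses at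
least one bit. -/
theorem le_card_of_hasManyBits {p k n : ℕ} (hn : n < 2 ^ p) (h : hasManyBits k n = true) :
    k ≤ ((Finset.range p).filter fun i => n.testBit i = true).card := by
  induction k generalizing n with
  | zero => simp
  | succ k ih =>
    cases n with
    | zero => simp [hasManyBits] at h
    | succ j =>
      have hlt : (j + 1) &&& j < j + 1 := Nat.lt_succ_of_le Nat.and_le_right
      refine (ih (n := (j + 1) &&& j) (hlt.trans hn) h).trans_lt (Finset.card_lt_card ?_)
      refine Finset.ssubset_iff_subset_ne.mpr ⟨fun i hi => ?_, fun heq => hlt.ne ?_⟩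
      · simp only [Finset.mem_filter, Nat.testBit_and, Bool.and_eq_true] at hi ⊢
        exact ⟨hi.1, hi.2.1⟩
      · refine Nat.eq_of_testBit_eq fun i => ?_
        by_cases hi : i < p
        · have := Finset.ext_iff.mp heq i
          simp only [Finset.mem_filter, Finset.mem_range, hi, true_and] at this
          exact Bool.eq_iff_iff.mpr this
        · have hp : 2 ^ p ≤ 2 ^ i := Nat.pow_le_pow_right (by simp) (not_lt.mp hi)
          rw [Nat.testBit_lt_two_pow ((hlt.trans hn).trans_le hp),
            Nat.testBit_lt_two_pow (hn.trans_le hp)]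

theorem le_card_add_of_hasManyBits {p k : ℕ} [NeZero p] {l : List ℕ} (hl : ∀ a ∈ l, a < p)
    {A : Finset (ZMod p)} (hA : ∀ a ∈ l, (a : ZMod p) ∈ A)
    (h : hasManyBits k (residueMask p (sumsetMask l)) = true) : k ≤ (A + A).card := by
  have hbit {i : ℕ} (hi : (residueMask p (sumsetMask l)).testBit i = true) :
      ∃ a ∈ l, ∃ b ∈ l, a + b = i ∨ a + b = p + i := by
    change (sumsetMask l % 2 ^ p ||| sumsetMask l >>> p).testBit i = true at hi
    rw [Nat.testBit_or, Bool.or_eq_true, Nat.testBit_mod_two_pow, Nat.testBit_shiftRight,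
      Bool.and_eq_true] at hi
    rcases hi with hi | hi
    · obtain ⟨a, ha, b, hb, hab⟩ := exists_add_of_testBit_sumsetMask hi.2
      exact ⟨a, ha, b, hb, .inl hab⟩
    · obtain ⟨a, ha, b, hb, hab⟩ := exists_add_of_testBit_sumsetMask hi
      exact ⟨a, ha, b, hb, .inr hab⟩
  have hlt : residueMask p (sumsetMask l) < 2 ^ p := by
    refine Nat.lt_pow_two_of_testBit _ fun i hi => ?_
    by_contra hne
    obtain ⟨a, ha, b, hb, hab⟩ := hbit (by simpa using hne)
    change (sumsetMask l % 2 ^ p ||| sumsetMask l >>> p).testBit i ≠ false at hne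
    have := hl a ha
    have := hl b hb
    rw [Bool.ne_false_iff, Nat.testBit_or, Bool.or_eq_true, Nat.testBit_mod_two_pow,
      Nat.testBit_shiftRight, Bool.and_eq_true, decide_eq_true_eq] at hne
    rcases hne with hne | hne
    · lia
    · obtain ⟨a, ha, b, hb, hab⟩ := exists_add_of_testBit_sumsetMask hne
      have := hl a ha
      have := hl b hb
      lia
  refine (le_card_of_hasManyBits hlt h).trans
    (Finset.card_le_card_of_injOn (fun i => (i : ZMod p)) ?_ ?_)
  · intro i hi
    obtain ⟨a, ha, b, hb, hab⟩ := hbit (Finset.mem_filter.mp hi).2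
    refine Finset.mem_coe.mpr (Finset.mem_add.mpr ⟨a, hA a ha, b, hA b hb, ?_⟩)
    rcases hab with hab | hab
    · rw [← Nat.cast_add, hab]
    · rw [← Nat.cast_add, hab]
      simp
  · intro i hi j hj hij
    have hi' : i < p := by simpa using (Finset.mem_filter.mp hi).1
    have hj' : j < p := by simpa using (Finset.mem_filter.mp hj).1
    simpa [ZMod.val_natCast, Nat.mod_eq_of_lt, hi', hj'] using congrArg ZMod.val hij

theorem le_card_add_of_sumsetsLarge_of_one_mem {p k : ℕ} [Fact p.Prime] {L : List ℕ}
    (hL : L.Nodup) (hLp : ∀ a ∈ L, a < p)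
    (hsq : ∀ s : ZMod p, s ^ 2 = 1 ∨ (s ^ 2).val ∈ L) (h : sumsetsLarge p k L = true)
    {A : Finset (ZMod p)} (hA : (A : Set (ZMod p)) ⊆ ringSquares (ZMod p)) (hcard : A.card = 5)
    (h1 : 1 ∈ A) : k ≤ (A + A).card := by
  set l : List ℕ := L.filter fun n : ℕ => decide ((n : ZMod p) ∈ A.erase 1) with hl
  have hlL : l.Sublist L := List.filter_sublist
  have himage : l.toFinset = (A.erase 1).image ZMod.val := by
    ext n
    simp only [hl, List.mem_toFinset, List.mem_filter, decide_eq_true_eq, Finset.mem_image]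
    constructor
    · rintro ⟨hn, hnA⟩
      exact ⟨n, hnA, ZMod.val_cast_of_lt (hLp n hn)⟩
    · rintro ⟨x, hx, rfl⟩
      obtain ⟨s, rfl⟩ := hA (Finset.mem_of_mem_erase hx)
      refine ⟨(hsq s).resolve_left (Finset.ne_of_mem_erase hx), ?_⟩
      rwa [ZMod.natCast_rightInverse]
  have hlen : l.length = 4 := by
    rw [← List.toFinset_card_of_nodup (hL.sublist hlL), himage,
      Finset.card_image_of_injective _ (ZMod.val_injective p), Finset.card_erase_of_mem h1, hcard]
  refine le_card_add_of_hasManyBits (l := 1 :: l) ?_ ?_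
    (List.all_eq_true.mp h l (List.mem_sublistsLen.mpr ⟨hlL, hlen⟩))
  · intro a ha
    rcases List.mem_cons.mp ha with rfl | ha
    · exact (Fact.out : p.Prime).one_lt
    · exact hLp a (hlL.subset ha)
  · intro a ha
    rcases List.mem_cons.mp ha with rfl | ha
    · simpa using h1
    · exact Finset.mem_of_mem_erase (of_decide_eq_true (List.mem_filter.mp ha).2)

/-- Dividing by a nonzero square of `A` preserves squares and the size of the sumset, so `1 ∈ A` may
be assumed. -/
theorem le_card_add_of_sumsetsLarge {p k : ℕ} (hp : p.Prime) {L : List ℕ}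
    (hL : L.Nodup) (hLp : ∀ a ∈ L, a < p)
    (hsq : ∀ s : ZMod p, s ^ 2 = 1 ∨ (s ^ 2).val ∈ L) (h : sumsetsLarge p k L = true)
    {A : Finset (ZMod p)} (hA : (A : Set (ZMod p)) ⊆ ringSquares (ZMod p)) (hcard : A.card = 5) :
    k ≤ (A + A).card := by
  have := Fact.mk hp
  obtain ⟨u, hu, hu0⟩ : ∃ u ∈ A, u ≠ 0 :=
    Finset.exists_mem_ne (by lia) 0
  obtain ⟨s, rfl⟩ := hA hu
  set f := AddMonoidHom.mulLeft (s ^ 2)⁻¹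
  have hf : Function.Injective f := mul_right_injective₀ (inv_ne_zero hu0)
  have hle : k ≤ (A.image f + A.image f).card := by
    refine le_card_add_of_sumsetsLarge_of_one_mem hL hLp hsq h ?_
      (by rw [Finset.card_image_of_injective _ hf, hcard])
      (Finset.mem_image.mpr ⟨s ^ 2, hu, inv_mul_cancel₀ hu0⟩)
    intro x hx
    obtain ⟨y, hy, rfl⟩ := Finset.mem_image.mp hx
    obtain ⟨t, rfl⟩ := hA hy
    exact ⟨s⁻¹ * t, by simp [f, mul_pow]⟩
  rwa [← Finset.image_add, Finset.card_image_of_injective _ hf] at hle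

/-! ### Five squares in arithmetic progression -/

theorem exists_smooth_ap (f : ℤ →* ℤ) (hneg : f (-1) = 1 ∨ f (-1) = -1)
    (h2 : f 2 = 1 ∨ f 2 = -1) (h3 : f 3 = 1 ∨ f 3 = -1) (h5 : f 5 = 1 ∨ f 5 = -1)
    (h7 : f 7 = 1 ∨ f 7 = -1) (h11 : f 11 = 1 ∨ f 11 = -1) (h13 : f 13 = 1 ∨ f 13 = -1) :
    ∃ a d c : ℤ, 0 < d ∧ d ≤ 37 ∧ c ≠ 0 ∧
      ∀ i ∈ [0, 1, 2, 3, 4], a + i * d = 0 ∨ f (a + i * d) = c := by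
  have hap (a d c : ℤ) (hd : 0 < d) (hd' : d ≤ 37) (hc : c ≠ 0)
      (h : ∀ i ∈ [0, 1, 2, 3, 4], a + i * d = 0 ∨ f (a + i * d) = c) :
      ∃ a d c : ℤ, 0 < d ∧ d ≤ 37 ∧ c ≠ 0 ∧
        ∀ i ∈ [0, 1, 2, 3, 4], a + i * d = 0 ∨ f (a + i * d) = c :=
    ⟨a, d, c, hd, hd', hc, h⟩
  -- Terms of the progressions below, factored over -1 and the primes up to 13.
  have n2 : f (-2) = f (-1) * f 2 := by simp only [← map_mul]; norm_num
  have n3 : f (-3) = f (-1) * f 3 := by simp only [← map_mul]; norm_num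
  have e4 : f 4 = f 2 * f 2 := by simp only [← map_mul]; norm_num
  have n4 : f (-4) = f (-1) * f 2 * f 2 := by simp only [← map_mul]; norm_num
  have n5 : f (-5) = f (-1) * f 5 := by simp only [← map_mul]; norm_num
  have e6 : f 6 = f 2 * f 3 := by simp only [← map_mul]; norm_num
  have n6 : f (-6) = f (-1) * f 2 * f 3 := by simp only [← map_mul]; norm_num
  have n7 : f (-7) = f (-1) * f 7 := by simp only [← map_mul]; norm_num
  have e8 : f 8 = f 2 * f 2 * f 2 := by simp only [← map_mul]; norm_num
  have n8 : f (-8) = f (-1) * f 2 * f 2 * f 2 := by simp only [← map_mul]; norm_num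
  have e9 : f 9 = f 3 * f 3 := by simp only [← map_mul]; norm_num
  have n9 : f (-9) = f (-1) * f 3 * f 3 := by simp only [← map_mul]; norm_num
  have e10 : f 10 = f 2 * f 5 := by simp only [← map_mul]; norm_num
  have n11 : f (-11) = f (-1) * f 11 := by simp only [← map_mul]; norm_num
  have e12 : f 12 = f 2 * f 2 * f 3 := by simp only [← map_mul]; norm_num
  have e14 : f 14 = f 2 * f 7 := by simp only [← map_mul]; norm_num
  have n14 : f (-14) = f (-1) * f 2 * f 7 := by simp only [← map_mul]; norm_num
  have n16 : f (-16) = f (-1) * f 2 * f 2 * f 2 * f 2 := by simp only [← map_mul]; norm_num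
  have n18 : f (-18) = f (-1) * f 2 * f 3 * f 3 := by simp only [← map_mul]; norm_num
  have e22 : f 22 = f 2 * f 11 := by simp only [← map_mul]; norm_num
  have n25 : f (-25) = f (-1) * f 5 * f 5 := by simp only [← map_mul]; norm_num
  have n26 : f (-26) = f (-1) * f 2 * f 13 := by simp only [← map_mul]; norm_num
  have n27 : f (-27) = f (-1) * f 3 * f 3 * f 3 := by simp only [← map_mul]; norm_num
  have e32 : f 32 = f 2 * f 2 * f 2 * f 2 * f 2 := by simp only [← map_mul]; norm_num
  have n35 : f (-35) = f (-1) * f 5 * f 7 := by simp only [← map_mul]; norm_num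
  have n36 : f (-36) = f (-1) * f 2 * f 2 * f 3 * f 3 := by simp only [← map_mul]; norm_num
  have n40 : f (-40) = f (-1) * f 2 * f 2 * f 2 * f 5 := by simp only [← map_mul]; norm_num
  have e44 : f 44 = f 2 * f 2 * f 11 := by simp only [← map_mul]; norm_num
  have e48 : f 48 = f 2 * f 2 * f 2 * f 2 * f 3 := by simp only [← map_mul]; norm_num
  have n49 : f (-49) = f (-1) * f 7 * f 7 := by simp only [← map_mul]; norm_num
  have n54 : f (-54) = f (-1) * f 2 * f 3 * f 3 * f 3 := by simp only [← map_mul]; norm_num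
  have n55 : f (-55) = f (-1) * f 5 * f 11 := by simp only [← map_mul]; norm_num
  have n63 : f (-63) = f (-1) * f 3 * f 3 * f 7 := by simp only [← map_mul]; norm_num
  have n80 : f (-80) = f (-1) * f 2 * f 2 * f 2 * f 2 * f 5 := by simp only [← map_mul]; norm_num
  have n84 : f (-84) = f (-1) * f 2 * f 2 * f 3 * f 7 := by simp only [← map_mul]; norm_num
  have n100 : f (-100) = f (-1) * f 2 * f 2 * f 5 * f 5 := by simp only [← map_mul]; norm_num
  -- Each branch stops once the signs fixed so far determine `f` on all nonzero terms of one
  -- progression.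
  rcases hneg with hneg | hneg
  · rcases h2 with h2 | h2
    · exact hap (-2) 1 1 (by simp) (by simp) (by simp) (by norm_num [*])
    · rcases h3 with h3 | h3
      · rcases h5 with h5 | h5
        · exact hap (-5) 2 1 (by simp) (by simp) (by simp) (by norm_num [*])
        · rcases h7 with h7 | h7
          · rcases h11 with h11 | h11
            · rcases h13 with h13 | h13
              · exact hap 9 1 1 (by simp) (by simp) (by simp) (by norm_num [*])
              · exact hap (-100) 37 1 (by simp) (by simp) (by simp) (by norm_num [*])
            · exact hap 2 3 (-1) (by simp) (by simp) (by simp) (by norm_num [*])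
          · exact hap (-40) 13 1 (by simp) (by simp) (by simp) (by norm_num [*])
      · rcases h5 with h5 | h5
        · rcases h7 with h7 | h7
          · rcases h11 with h11 | h11
            · exact hap (-16) 5 1 (by simp) (by simp) (by simp) (by norm_num [*])
            · rcases h13 with h13 | h13
              · exact hap (-84) 29 (-1) (by simp) (by simp) (by simp) (by norm_num [*])
              · exact hap 10 1 (-1) (by simp) (by simp) (by simp) (by norm_num [*])
          · exact hap (-14) 5 1 (by simp) (by simp) (by simp) (by norm_num [*])
        · rcases h7 with h7 | h7
          · rcases h11 with h11 | h11
            · exact hap (-16) 5 1 (by simp) (by simp) (by simp) (by norm_num [*])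
            · exact hap 2 3 (-1) (by simp) (by simp) (by simp) (by norm_num [*])
          · exact hap (-14) 5 1 (by simp) (by simp) (by simp) (by norm_num [*])
  · rcases h2 with h2 | h2
    · rcases h3 with h3 | h3
      · exact hap 0 1 1 (by simp) (by simp) (by simp) (by norm_num [*])
      · rcases h5 with h5 | h5
        · rcases h7 with h7 | h7
          · rcases h11 with h11 | h11
            · exact hap 7 1 1 (by simp) (by simp) (by simp) (by norm_num [*])
            · rcases h13 with h13 | h13
              · exact hap 1 3 1 (by simp) (by simp) (by simp) (by norm_num [*])
              · exact hap (-80) 31 (-1) (by simp) (by simp) (by simp) (by norm_num [*])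
          · exact hap (-9) 4 (-1) (by simp) (by simp) (by simp) (by norm_num [*])
        · exact hap (-16) 7 (-1) (by simp) (by simp) (by simp) (by norm_num [*])
    · rcases h3 with h3 | h3
      · rcases h5 with h5 | h5
        · rcases h7 with h7 | h7
          · exact hap 1 2 1 (by simp) (by simp) (by simp) (by norm_num [*])
          · exact hap (-36) 11 (-1) (by simp) (by simp) (by simp) (by norm_num [*])
        · exact hap (-8) 3 1 (by simp) (by simp) (by simp) (by norm_num [*])
      · rcases h5 with h5 | h5
        · rcases h7 with h7 | h7
          · rcases h11 with h11 | h11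
            · exact hap (-54) 19 (-1) (by simp) (by simp) (by simp) (by norm_num [*])
            · exact hap (-25) 9 (-1) (by simp) (by simp) (by simp) (by norm_num [*])
          · exact hap (-9) 4 (-1) (by simp) (by simp) (by simp) (by norm_num [*])
        · exact hap (-8) 3 1 (by simp) (by simp) (by simp) (by norm_num [*])

/-- For `p ≥ 41` there is an arithmetic progression of five squares modulo `p`. -/
theorem exists_five_term_ap_squares {p : ℕ} [Fact p.Prime] (hp : 41 ≤ p) :
    ∃ a d : ZMod p, d ≠ 0 ∧ ∀ i ∈ Finset.range 5, IsSquare (a + i * d) := by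
  -- The bound 41 covers the primes up to 13 and the common difference, at most 37.
  have hcast {n : ℤ} (h0 : n ≠ 0) (hn : |n| < 41) : (n : ZMod p) ≠ 0 := by
    rw [Ne, ZMod.intCast_zmod_eq_zero_iff_dvd]
    intro h
    have := Int.eq_zero_of_abs_lt_dvd h (by lia)
    exact h0 this
  let f : ℤ →* ℤ :=
    (quadraticChar (ZMod p)).toMonoidHom.comp (Int.castRingHom (ZMod p)).toMonoidHom
  have hf (n : ℤ) : f n = quadraticChar (ZMod p) n := rfl
  have hval {n : ℤ} (h0 : n ≠ 0) (hn : |n| < 41) : f n = 1 ∨ f n = -1 :=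
    quadraticChar_dichotomy (hcast h0 hn)
  obtain ⟨a, d, c, hd, hd37, hc, h⟩ := exists_smooth_ap f (hval (by simp) (by simp))
    (hval (by simp) (by simp)) (hval (by simp) (by simp)) (hval (by simp) (by simp))
    (hval (by simp) (by simp)) (hval (by simp) (by simp)) (hval (by simp) (by simp))
  obtain ⟨u, hu, hu0⟩ : ∃ u : ZMod p, quadraticChar (ZMod p) u = c ∧ u ≠ 0 := by
    have huc (i : ℤ) (hi : i ∈ [(0 : ℤ), 1, 2, 3, 4]) (h0 : a + i * d ≠ 0) :
        ∃ u : ZMod p, quadraticChar (ZMod p) u = c ∧ u ≠ 0 := by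
      have hu := (h i hi).resolve_left h0
      rw [hf] at hu
      exact ⟨_, hu, fun h0 => hc (by rw [← hu, h0, MulChar.map_zero])⟩
    -- The multiplier `u` is itself a nonzero term of the progression: `a`, or `a + d = d` when `a =
    -- 0`.
    by_cases h0 : a = 0
    · exact huc 1 (by simp) (by lia)
    · exact huc 0 (by simp) (by lia)
  refine ⟨u * a, u * d, mul_ne_zero hu0 (hcast hd.ne' (by grind)), fun i hi => ?_⟩
  have hi' : (i : ℤ) ∈ [(0 : ℤ), 1, 2, 3, 4] := by
    have : i < 5 := Finset.mem_range.mp hi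
    interval_cases i <;> simp
  have hrw : u * a + i * (u * d) = u * ((a + i * d : ℤ) : ZMod p) := by
    push_cast
    ring
  rw [hrw]
  rcases h i hi' with h0 | h1
  · simp [h0]
  · by_cases hz : ((a + i * d : ℤ) : ZMod p) = 0
    · simp [hz]
    · rw [← quadraticChar_one_iff_isSquare (mul_ne_zero hu0 hz), map_mul, hu, ← hf, h1]
      rcases quadraticChar_dichotomy hu0 with h | h <;> rw [← hu, h] <;> rfl

theorem card_image_ap {p : ℕ} [Fact p.Prime] (hp : 5 ≤ p) {a d : ZMod p} (hd : d ≠ 0) :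
    ((Finset.range 5).image fun i : ℕ => a + i * d).card = 5 := by
  rw [Finset.card_image_of_injOn, Finset.card_range]
  intro i hi j hj hij
  have hi' : i < p := (Finset.mem_range.mp hi).trans_le hp
  have hj' : j < p := (Finset.mem_range.mp hj).trans_le hp
  have : (i : ZMod p) = j := mul_right_cancel₀ hd (add_left_cancel hij)
  simpa [ZMod.val_natCast, Nat.mod_eq_of_lt, hi', hj'] using congrArg ZMod.val this

theorem card_image_ap_add_le {p : ℕ} (a d : ZMod p) :
    ((Finset.range 5).image (fun i : ℕ => a + i * d) +
      (Finset.range 5).image fun i : ℕ => a + i * d).card ≤ 9 := by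
  refine (Finset.card_le_card (t := (Finset.range 9).image fun i : ℕ => 2 * a + i * d)
    fun x hx => ?_).trans (Finset.card_image_le.trans_eq (Finset.card_range 9))
  obtain ⟨y, hy, z, hz, rfl⟩ := Finset.mem_add.mp hx
  obtain ⟨i, hi, rfl⟩ := Finset.mem_image.mp hy
  obtain ⟨j, hj, rfl⟩ := Finset.mem_image.mp hz
  rw [Finset.mem_range] at hi hj
  refine Finset.mem_image.mpr ⟨i + j, Finset.mem_range.mpr (by lia), ?_⟩
  push_cast
  ring

/-! ### Bounds for the individual primes -/

theorem nine_le_card_add {p : ℕ} (hp : p.Prime) (h11 : 11 ≤ p) {A : Finset (ZMod p)}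
    (hA : A.card = 5) : 9 ≤ (A + A).card := by
  have hne : A.Nonempty := Finset.card_pos.mp (by lia)
  have := ZMod.cauchy_davenport hp hne hne
  rw [hA] at this
  lia

theorem minSquareSumset_eq {n k : ℕ} {R : Type*} [Ring R] [DecidableEq R]
    (hle : ∃ A : Finset R, (A : Set R) ⊆ ringSquares R ∧ A.card = n ∧ (A + A).card ≤ k)
    (hge : ∀ A : Finset R, (A : Set R) ⊆ ringSquares R → A.card = n → k ≤ (A + A).card) :
    minSquareSumset n R = k := by
  obtain ⟨A, hA, hn, hk⟩ := hle
  exact le_antisymm (iInf_le_of_le ⟨A, hA, hn⟩ (by exact_mod_cast hk))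
    (le_iInf fun B => by exact_mod_cast hge B.1 B.2.1 B.2.2)

theorem exists_card_add_le_nine {p : ℕ} (hp : p.Prime) (h : p = 17 ∨ p = 23 ∨ 41 ≤ p) :
    ∃ A : Finset (ZMod p), (A : Set (ZMod p)) ⊆ ringSquares (ZMod p) ∧ A.card = 5 ∧
      (A + A).card ≤ 9 := by
  obtain ⟨a, d, hd, hsq⟩ : ∃ a d : ZMod p, d ≠ 0 ∧
      ∀ i ∈ Finset.range 5, IsSquare (a + i * d) := by
    rcases h with rfl | rfl | h
    -- Modulo 17 this is -2, -1, 0, 1, 2.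
    · exact ⟨15, 1, by decide, by decide⟩
    · exact ⟨0, 1, by decide, by decide⟩
    · have := Fact.mk hp
      exact exists_five_term_ap_squares h
  have := Fact.mk hp
  refine ⟨(Finset.range 5).image fun i : ℕ => a + i * d, fun x hx => ?_,
    card_image_ap (by lia) hd, card_image_ap_add_le a d⟩
  obtain ⟨i, hi, rfl⟩ := Finset.mem_image.mp hx
  obtain ⟨r, hr⟩ := hsq i hi
  exact ⟨r, by rw [hr, sq]⟩

theorem exists_squares_card_add_le {p k : ℕ} [NeZero p] (s : Finset (ZMod p))
    (hcard : (s.image (· ^ 2)).card = 5)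
    (hadd : (s.image (· ^ 2) + s.image (· ^ 2)).card ≤ k) :
    ∃ A : Finset (ZMod p), (A : Set (ZMod p)) ⊆ ringSquares (ZMod p) ∧ A.card = 5 ∧
      (A + A).card ≤ k := by
  refine ⟨s.image (· ^ 2), fun x hx => ?_, hcard, hadd⟩
  obtain ⟨r, -, rfl⟩ := Finset.mem_image.mp hx
  exact ⟨r, rfl⟩

theorem exists_card_add_le_ten {p : ℕ} (h : p = 11 ∨ p = 19 ∨ p = 29 ∨ p = 31 ∨ p = 37) :
    ∃ A : Finset (ZMod p), (A : Set (ZMod p)) ⊆ ringSquares (ZMod p) ∧ A.card = 5 ∧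
      (A + A).card ≤ 10 := by
  rcases h with rfl | rfl | rfl | rfl | rfl
  · exact exists_squares_card_add_le {1, 5, 2, 4, 3} (by decide) (by decide +kernel)
  · exact exists_squares_card_add_le {1, 2, 5, 3, 6} (by decide) (by decide +kernel)
  · exact exists_squares_card_add_le {1, 2, 6, 7, 9} (by decide) (by decide +kernel)
  · exact exists_squares_card_add_le {1, 8, 15, 13, 12} (by decide) (by decide +kernel)
  · exact exists_squares_card_add_le {1, 15, 9, 16, 6} (by decide) (by decide +kernel)

theorem exists_card_add_le_eleven :
    ∃ A : Finset (ZMod 13), (A : Set (ZMod 13)) ⊆ ringSquares (ZMod 13) ∧ A.card = 5 ∧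
      (A + A).card ≤ 11 :=
  exists_squares_card_add_le {0, 1, 4, 2, 6} (by decide) (by decide +kernel)

theorem ten_le_card_add {p : ℕ} (hp : p.Prime)
    (h : p = 11 ∨ p = 19 ∨ p = 29 ∨ p = 31 ∨ p = 37) {A : Finset (ZMod p)}
    (hA : (A : Set (ZMod p)) ⊆ ringSquares (ZMod p)) (hcard : A.card = 5) :
    10 ≤ (A + A).card := by
  rcases h with rfl | rfl | rfl | rfl | rfl
  · exact le_card_add_of_sumsetsLarge hp (L := [0, 3, 4, 5, 9]) (by decide)
      (by decide) (by decide) (by decide +kernel) hA hcard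
  · exact le_card_add_of_sumsetsLarge hp (L := [0, 4, 5, 6, 7, 9, 11, 16, 17]) (by decide)
      (by decide) (by decide) (by decide +kernel) hA hcard
  · exact le_card_add_of_sumsetsLarge hp (L := [0, 4, 5, 6, 7, 9, 13, 16, 20, 22, 23, 24, 25, 28])
      (by decide) (by decide) (by decide +kernel) (by decide +kernel) hA hcard
  · exact le_card_add_of_sumsetsLarge hp (L := [0, 2, 4, 5, 7, 8, 9, 10, 14, 16, 18, 19, 20, 25, 28])
      (by decide) (by decide) (by decide +kernel) (by decide +kernel) hA hcard
  · exact le_card_add_of_sumsetsLarge hp (L := [0, 3, 4, 7, 9, 10, 11, 12, 16, 21, 25, 26, 27, 28, 30, 33, 34, 36])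
      (by decide) (by decide) (by decide +kernel) (by decide +kernel) hA hcard

theorem eleven_le_card_add {A : Finset (ZMod 13)}
    (hA : (A : Set (ZMod 13)) ⊆ ringSquares (ZMod 13)) (hcard : A.card = 5) :
    11 ≤ (A + A).card :=
  le_card_add_of_sumsetsLarge (by norm_num) (L := [0, 3, 4, 9, 10, 12]) (by decide) (by decide)
    (by decide) (by decide +kernel) hA hcard

/-- The primes up to 7 have at most four squares, zero included. -/
theorem eleven_le_of_card_eq_five {p : ℕ} (hp : p.Prime) {A : Finset (ZMod p)}
    (hA : (A : Set (ZMod p)) ⊆ ringSquares (ZMod p)) (hcard : A.card = 5) : 11 ≤ p := by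
  have key {q : ℕ} [NeZero q] (hq : ((Finset.univ : Finset (ZMod q)).image (· ^ 2)).card < 5)
      {A : Finset (ZMod q)} (hA : (A : Set (ZMod q)) ⊆ ringSquares (ZMod q)) :
      A.card ≠ 5 := by
    refine ((Finset.card_le_card fun x hx => ?_).trans_lt hq).ne
    obtain ⟨r, rfl⟩ := hA hx
    exact Finset.mem_image_of_mem _ (Finset.mem_univ r)
  by_contra! hlt
  have hp' : p = 2 ∨ p = 3 ∨ p = 5 ∨ p = 7 := by
    interval_cases p <;> revert hp <;> decide
  rcases hp' with rfl | rfl | rfl | rfl <;> exact key (by decide) hA hcard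

theorem mainTheorem7 (p : ℕ) (hp : p.Prime) :
    ((∃ A : Finset (ZMod p), (A : Set (ZMod p)) ⊆ ringSquares (ZMod p) ∧ A.card = 5) ↔ 11 ≤ p) ∧
    ((p = 17 ∨ p = 23 ∨ 41 ≤ p) → minSquareSumset 5 (ZMod p) = 9) ∧
    ((p = 11 ∨ p = 19 ∨ p = 29 ∨ p = 31 ∨ p = 37) → minSquareSumset 5 (ZMod p) = 10) ∧
    (p = 13 → minSquareSumset 5 (ZMod p) = 11) := by
  refine ⟨⟨fun ⟨A, hA, hcard⟩ => eleven_le_of_card_eq_five hp hA hcard, fun h11 => ?_⟩,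
    fun h => minSquareSumset_eq (exists_card_add_le_nine hp h)
      fun A _ hcard => nine_le_card_add hp (by lia) hcard,
    fun h => minSquareSumset_eq (exists_card_add_le_ten h)
      fun A hA hcard => ten_le_card_add hp h hA hcard, ?_⟩
  · have hcases : (p = 17 ∨ p = 23 ∨ 41 ≤ p) ∨
        (p = 11 ∨ p = 19 ∨ p = 29 ∨ p = 31 ∨ p = 37) ∨ p = 13 := by
      by_cases h41 : 41 ≤ p
      · exact .inl (.inr (.inr h41))
      · rw [not_le] at h41
        interval_cases p <;> revert hp <;> decide
    rcases hcases with h | h | rfl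
    · obtain ⟨A, hA, hcard, -⟩ := exists_card_add_le_nine hp h
      exact ⟨A, hA, hcard⟩
    · obtain ⟨A, hA, hcard, -⟩ := exists_card_add_le_ten h
      exact ⟨A, hA, hcard⟩
    · obtain ⟨A, hA, hcard, -⟩ := exists_card_add_le_eleven
      exact ⟨A, hA, hcard⟩
  · rintro rfl
    exact minSquareSumset_eq exists_card_add_le_eleven
      fun A hA hcard => eleven_le_card_add hA hcard
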